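/- Let $H=\bigcup_{i\ge 1}C_i\subset\mathbb{R}^2$ be the Hawaiian earring, where $C_i$ is the circle of radius $1/i$ centred at $(1/i,0)$, let $X_n=C_1\cup\dots\cup C_n$ (and $X_0=\{0\}$), and let $H\to X_n$ be the retraction that collapses all circles $C_i$ with $i>n$ to the origin. Let $F_n$ be the free group on $n$ generators, identified with $\pi_1(X_n,0)$ so that the $i$-th generator is the class of the loop running once around $C_i$, let $F_{n+1}\to F_n$ be the homomorphism that kills the last generator and fixes the others, and let $\widehat F=\varprojlim F_n$. Let $\mathrm{HEG}\le\widehat F$ be the Hawaiian earring group $\pi_1(H,0)$, viewed as a subgroup of $\widehat F$ through the canonical homomorphism $\pi_1(H,0)\to\varprojlim\pi_1(X_n,0)=\widehat F$ induced by the retractions $H\to X_n$; that is, $\mathrm{HEG}$ is the image of this homomorphism. Let $\mathrm{Ker}_{\mathbb{Z}}(\widehat F)$ be the intersection of the kernels of all group homomorphisms $\widehat F\to\mathbb{Z}$. Then $\widehat F$ is the internal product of its subgroups $\mathrm{HEG}$ and $\mathrm{Ker}_{\mathbb{Z}}(\widehat F)$: $$\widehat F=\mathrm{HEG}\cdot\mathrm{Ker}_{\mathbb{Z}}(\widehat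 F),$$ i.e. every element of $\widehat F$ is a product $hk$ with $h\in\mathrm{HEG}$ and $k\in\mathrm{Ker}_{\mathbb{Z}}(\widehat F)$. -/

import Mathlib

open scoped Pointwise

noncomputable section

/-! ### The Hawaiian earring, the finite wedges of circles and the collapsing maps -/

/-- The radius `1 / (i + 1)` of the `i`-th circle. -/
def earringRadius (i : ℕ) : ℝ := 1 / ((i : ℝ) + 1)

theorem earringRadius_pos (i : ℕ) : 0 < earringRadius i := by
  unfold earringRadius; positivity

/-- The `i`-th circle: radius `1 / (i + 1)`, centre `1 / (i + 1)` on the real axis. -/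
def earringCircle (i : ℕ) : Set ℂ :=
  Metric.sphere ((earringRadius i : ℝ) : ℂ) (earringRadius i)

/-- The Hawaiian earring `H`, with the subspace topology of the plane. -/
def HawaiianEarring : Set ℂ := ⋃ i : ℕ, earringCircle i

/-- The wedge `X n` of the first `n` circles (a point if `n = 0`). -/
def CircleWedge (n : ℕ) : Set ℂ := {0} ∪ ⋃ i : Fin n, earringCircle i

theorem mem_earringCircle {i : ℕ} {z : ℂ} :
    z ∈ earringCircle i ↔ ((i : ℝ) + 1) * Complex.normSq z = 2 * z.re := by
  have hr := earringRadius_pos i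
  have hi : (0 : ℝ) < (i : ℝ) + 1 := by positivity
  have key : Complex.normSq (z - (earringRadius i : ℂ)) =
      Complex.normSq z - 2 * earringRadius i * z.re + earringRadius i ^ 2 := by
    simp [Complex.normSq_apply]; ring
  unfold earringCircle
  rw [mem_sphere_iff_norm, ← sq_eq_sq₀ (norm_nonneg _) hr.le, Complex.sq_norm, key]
  have h1 : earringRadius i * ((i : ℝ) + 1) = 1 := by
    unfold earringRadius; field_simp
  constructor
  · intro h
    have h2 : Complex.normSq z = 2 * earringRadius i * z.re := by linarith
    rw [h2]; linear_combination (2 * z.re) * h1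
  · intro h
    linear_combination earringRadius i * h - Complex.normSq z * h1

theorem zero_mem_earringCircle (i : ℕ) : (0 : ℂ) ∈ earringCircle i := by
  rw [mem_earringCircle]; simp

/-- The base point of `H`, the common point of all circles. -/
def earringBase : HawaiianEarring :=
  ⟨0, Set.mem_iUnion.2 ⟨0, zero_mem_earringCircle 0⟩⟩

/-- The base point of `X n`. -/
def wedgeBase (n : ℕ) : CircleWedge n := ⟨0, Or.inl rfl⟩

open Classical in
/-- The underlying function of the collapse: the first `n` circles are kept, all the others are
sent to the base point. -/
def collapseFun (n : ℕ) (z : HawaiianEarring) : CircleWedge n :=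
  if h : (z : ℂ) ∈ CircleWedge n then ⟨z, h⟩ else wedgeBase n

theorem continuous_collapseFun (n : ℕ) : Continuous (collapseFun n) := by
  rw [continuous_induced_rng, continuous_iff_continuousAt]
  intro z
  have hval : ∀ w : HawaiianEarring, (w : ℂ) ∈ CircleWedge n →
      (Subtype.val ∘ collapseFun n) w = (w : ℂ) := fun w h => by simp [collapseFun, h]
  have hval' : ∀ w : HawaiianEarring, (w : ℂ) ∉ CircleWedge n →
      (Subtype.val ∘ collapseFun n) w = 0 := fun w h => by simp [collapseFun, h, wedgeBase]
  have hin : ∀ w : HawaiianEarring, (w : ℂ) ≠ 0 → ((w : ℂ) ∈ CircleWedge n ↔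
      2 * (w : ℂ).re < ((n : ℝ) + 1 / 2) * Complex.normSq w) := by
    rintro ⟨w, hw⟩ h0
    simp only at h0 ⊢
    have hpos : 0 < Complex.normSq w := Complex.normSq_pos.2 h0
    obtain ⟨i, hi⟩ := Set.mem_iUnion.1 hw
    rw [mem_earringCircle] at hi
    rw [← hi, mul_lt_mul_iff_left₀ hpos]
    constructor
    · rintro (h | h)
      · exact absurd h h0
      · obtain ⟨j, hj⟩ := Set.mem_iUnion.1 h
        rw [mem_earringCircle, ← hi] at hj
        have := mul_right_cancel₀ hpos.ne' hj
        have hjn : ((j : ℕ) : ℝ) + 1 ≤ n := by exact_mod_cast j.2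
        linarith
    · intro h
      have h2 : i < n := by
        by_contra hc
        have : (n : ℝ) ≤ i := by exact_mod_cast not_lt.1 hc
        linarith
      exact Or.inr (Set.mem_iUnion.2 ⟨⟨i, h2⟩, mem_earringCircle.2 hi⟩)
  have hcoe : Continuous fun w : HawaiianEarring => (w : ℂ) := continuous_subtype_val
  have hsq : Continuous fun w : HawaiianEarring => Complex.normSq (w : ℂ) :=
    Complex.continuous_normSq.comp hcoe
  have hre : Continuous fun w : HawaiianEarring => (w : ℂ).re := Complex.continuous_re.comp hcoe
  by_cases h0 : (z : ℂ) = 0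
  · have hz : (Subtype.val ∘ collapseFun n) z = 0 := by
      rw [hval z (Or.inl h0), h0]
    rw [ContinuousAt, hz]
    refine squeeze_zero_norm (a := fun w : HawaiianEarring => ‖(w : ℂ)‖) (fun w => ?_) ?_
    · by_cases hw : (w : ℂ) ∈ CircleWedge n
      · rw [hval w hw]
      · rw [hval' w hw]; simp
    · have := (hcoe.norm).tendsto z
      simpa [h0] using this
  · have hne : ∀ᶠ w : HawaiianEarring in nhds z, (w : ℂ) ≠ 0 :=
      hcoe.continuousAt.eventually_ne h0
    by_cases hz : (z : ℂ) ∈ CircleWedge n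
    · have hlt := (hin z h0).1 hz
      have hev : ∀ᶠ w : HawaiianEarring in nhds z,
          2 * (w : ℂ).re < ((n : ℝ) + 1 / 2) * Complex.normSq w :=
        (continuous_const.mul hre).continuousAt.eventually_lt
          (continuous_const.mul hsq).continuousAt hlt
      refine hcoe.continuousAt.congr ?_
      filter_upwards [hne, hev] with w h1 h2
      exact (hval w ((hin w h1).2 h2)).symm
    · have hlt : ((n : ℝ) + 1 / 2) * Complex.normSq z < 2 * (z : ℂ).re := by
        refine lt_of_le_of_ne (not_lt.1 fun h => hz ((hin z h0).2 h)) fun h => ?_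
        have hpos : 0 < Complex.normSq (z : ℂ) := Complex.normSq_pos.2 h0
        obtain ⟨i, hi⟩ := Set.mem_iUnion.1 z.2
        rw [mem_earringCircle, ← h] at hi
        have h3 := mul_right_cancel₀ hpos.ne' hi
        have h4 : (2 * (i + 1) : ℝ) = 2 * n + 1 := by linarith
        have h5 : 2 * (i + 1) = 2 * n + 1 := by exact_mod_cast h4
        omega
      have hev : ∀ᶠ w : HawaiianEarring in nhds z,
          ((n : ℝ) + 1 / 2) * Complex.normSq w < 2 * (w : ℂ).re :=
        (continuous_const.mul hsq).continuousAt.eventually_lt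
          (continuous_const.mul hre).continuousAt hlt
      refine (continuousAt_const (y := (0 : ℂ))).congr ?_
      filter_upwards [hne, hev] with w h1 h2
      exact (hval' w fun h => absurd ((hin w h1).1 h) (not_lt.2 h2.le)).symm

/-- The collapsing map `H → X n`. -/
def collapse (n : ℕ) : C(HawaiianEarring, CircleWedge n) :=
  ⟨collapseFun n, continuous_collapseFun n⟩

theorem collapse_base (n : ℕ) : collapse n earringBase = wedgeBase n := by
  have h : (earringBase : ℂ) ∈ CircleWedge n := Or.inl rfl
  change collapseFun n earringBase = wedgeBase n
  rw [collapseFun, dif_pos h]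
  rfl

/-- The loop in `X n` that runs once around the `i`-th circle,
`t ↦ (1 - exp (2 π I t)) / (i + 1)`. -/
def wedgeLoop (n : ℕ) (i : Fin n) : Path (wedgeBase n) (wedgeBase n) where
  toFun t := ⟨(earringRadius i : ℂ) * (1 - Complex.exp (2 * Real.pi * (t : ℝ) * Complex.I)), by
    refine Or.inr (Set.mem_iUnion.2 ⟨i, ?_⟩)
    have h : ‖Complex.exp (2 * Real.pi * (t : ℝ) * Complex.I)‖ = 1 := by
      have := Complex.norm_exp_ofReal_mul_I (2 * Real.pi * (t : ℝ))
      push_cast at this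
      exact this
    rw [earringCircle, mem_sphere_iff_norm]
    have e : (earringRadius i : ℂ) * (1 - Complex.exp (2 * Real.pi * (t : ℝ) * Complex.I)) -
        (earringRadius i : ℂ) =
        -((earringRadius i : ℂ) * Complex.exp (2 * Real.pi * (t : ℝ) * Complex.I)) := by ring
    rw [e, norm_neg, norm_mul, h, mul_one, Complex.norm_real, Real.norm_eq_abs,
      abs_of_pos (earringRadius_pos i)]⟩
  continuous_toFun := by
    refine Continuous.subtype_mk ?_ _
    fun_prop
  source' := by
    apply Subtype.ext
    simp [wedgeBase]
  target' := by
    apply Subtype.ext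
    simp [wedgeBase, Complex.exp_two_pi_mul_I]

/-! ### The inverse limit of the free groups of finite rank -/

/-- The bonding homomorphism `F (n + 1) → F n`: the last generator goes to `1`, every other
generator goes to the generator of the same index. -/
def freeBond (n : ℕ) : FreeGroup (Fin (n + 1)) →* FreeGroup (Fin n) :=
  FreeGroup.lift fun i => if h : (i : ℕ) < n then FreeGroup.of ⟨i, h⟩ else 1

/-- The inverse limit `F̂` of `F 0 ← F 1 ← F 2 ← ⋯`, as the group of coherent sequences. -/
def freeLimit : Subgroup (∀ n : ℕ, FreeGroup (Fin n)) where
  carrier := {x | ∀ n, freeBond n (x (n + 1)) = x n}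
  one_mem' n := by simp
  mul_mem' {x y} hx hy n := by simp [hx n, hy n]
  inv_mem' {x} hx n := by simp [hx n]

/-- The projection `F̂ → F n`. -/
def freeLimitProj (n : ℕ) : freeLimit →* FreeGroup (Fin n) :=
  (Pi.evalMonoidHom (fun n : ℕ => FreeGroup (Fin n)) n).comp freeLimit.subtype

/-! ### The Hawaiian earring group inside `F̂` -/

/-- The standard isomorphism `F n = π₁ (X n)`, as a homomorphism: the `i`-th free generator goes to
the class of the loop around the `i`-th circle. -/
def freeToWedge (n : ℕ) : FreeGroup (Fin n) →* FundamentalGroup (CircleWedge n) (wedgeBase n) :=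
  FreeGroup.lift fun i =>
    FundamentalGroup.fromPath (Path.Homotopic.Quotient.mk (wedgeLoop n i))

/-- The homomorphism `π₁ H → π₁ (X n)` induced by the collapse. -/
def earringToWedge (n : ℕ) : FundamentalGroup HawaiianEarring earringBase →*
    FundamentalGroup (CircleWedge n) (wedgeBase n) :=
  FundamentalGroup.mapOfEq (collapse n) (collapse_base n)

/-- The Hawaiian earring group `π₁ H` as a subgroup of `F̂`: the image of the homomorphism to
the inverse limit that is induced by the collapsing maps. Under the identifications
`F n = π₁ (X n)` it consists of the coherent sequences `x` for which there is one `g` in `π₁ H`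
that projects to `x n` in `π₁ (X n)` for every `n`. -/
def HEG : Subgroup freeLimit :=
  (MonoidHom.pi earringToWedge).range.comap
    (MonoidHom.pi fun n => (freeToWedge n).comp (freeLimitProj n))

theorem mem_HEG {x : freeLimit} : x ∈ HEG ↔
    ∃ g : FundamentalGroup HawaiianEarring earringBase,
      ∀ n, earringToWedge n g = freeToWedge n (freeLimitProj n x) := by
  simp [HEG, MonoidHom.mem_range, funext_iff]

/-! ### The subgroup `Ker_A G` -/

/-- The intersection of the kernels of all homomorphisms from `G` to `A`. -/
def kerInto (A G : Type*) [Group A] [Group G] : Subgroup G :=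
  ⨅ f : G →* A, f.ker

end

/-!
Two facts together give the factorization. Write `K n` for the kernel of the projection `F̂ → F n`.

*Homomorphisms to `ℤ` only see exponent sums.* Suppose `f : F̂ → ℤ` does not vanish on any `K n`,
and choose `x n ∈ K n` with `a n = f (x n) ≠ 0`. Since `x n` is trivial in the first `n` coordinates,
nested products such as `y 0 = x 0 * (x 1 * (x 2 * ⋯) ^ k 1) ^ k 0` converge in `F̂`, for any
exponents `k n`. Their tails satisfy `f (y m) = a m + k m * f (y (m + 1))`. With `k m = |a m| + 2`
the integers `f (y m)` are at least halved in each step until they vanish, and from then on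
`a m = 0`, a contradiction (`exists_forall_freeLimitProj_eq_one`). Hence `f` factors through some
`F n`, and its value at `x` is determined by the exponent sums `e i` of the generators in `x`. So
`f` takes the same value at `x` and at the infinite product of the powers `a i ^ e i` of the generators
(`map_genPowProd_limitExponent`).

*Infinite products of powers of generators lie in `HEG`.* Loops that shrink to the base point can be
concatenated to one loop, the `m`-th of them using the time from `1 - 2 ^ (-m)` to
`1 - 2 ^ (-m - 1)` (`infiniteConcat`). Applied to loops that wind `e i` times around the `i`-th
circle, this gives a loop in `H`. The collapse to `X n` makes its tail from the `n`-th loop on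
constant, so that the class of the image is the corresponding finite product (`genPowProd_mem_HEG`).

Therefore `x` is the product of `h = genPowProd (limitExponent x) ∈ HEG` and `h⁻¹ * x`, which every
homomorphism to `ℤ` kills.
-/

noncomputable section

/-! ### Homomorphisms from the inverse limit to `ℤ` -/

theorem freeLimitProj_coherent (x : freeLimit) (n : ℕ) :
    freeBond n (freeLimitProj (n + 1) x) = freeLimitProj n x := x.2 n

theorem freeLimit_ext {x y : freeLimit} (h : ∀ n, freeLimitProj n x = freeLimitProj n y) :
    x = y := Subtype.ext (funext h)

/-- An element that dies in `F n` dies in every `F m` with `m ≤ n`. -/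
theorem freeLimitProj_eq_one_of_le {x : freeLimit} {m n : ℕ} (hmn : m ≤ n)
    (hx : freeLimitProj n x = 1) : freeLimitProj m x = 1 := by
  induction n, hmn using Nat.le_induction with
  | base => exact hx
  | succ n _ ih => exact ih (by rw [← freeLimitProj_coherent, hx, map_one])

/-- The first `j` steps of the nested product
`x m * (x (m + 1) * (x (m + 2) * ⋯) ^ k (m + 1)) ^ k m` in an arbitrary group. -/
def nestedProd {G : Type*} [Group G] (x : ℕ → G) (k : ℕ → ℕ) : ℕ → ℕ → G
  | 0, _ => 1
  | j + 1, m => x m * nestedProd x k j (m + 1) ^ k m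

theorem map_nestedProd {G G' : Type*} [Group G] [Group G'] (φ : G →* G') (x : ℕ → G) (k : ℕ → ℕ)
    (j m : ℕ) : φ (nestedProd x k j m) = nestedProd (fun i => φ (x i)) k j m := by
  induction j generalizing m with
  | zero => simp [nestedProd]
  | succ j ih => simp [nestedProd, ih]

/-- The nested product is not changed by further factors that are trivial. -/
theorem nestedProd_succ_of_eq_one {G : Type*} [Group G] {x : ℕ → G} (k : ℕ → ℕ) {n : ℕ}
    (hx : ∀ i, n ≤ i → x i = 1) (j m : ℕ) (h : n ≤ j + m) :
    nestedProd x k (j + 1) m = nestedProd x k j m := by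
  induction j generalizing m with
  | zero => simp [nestedProd, hx m (by omega)]
  | succ j ih =>
    rw [nestedProd, ih (m + 1) (by omega)]
    rfl

/-- If `x n` dies in `F n` for every `n`, then the infinite nested product
`x m * (x (m + 1) * (x (m + 2) * ⋯) ^ k (m + 1)) ^ k m` converges in the inverse limit. -/
theorem exists_nestedProd (x : ℕ → freeLimit) (hx : ∀ n, freeLimitProj n (x n) = 1) (k : ℕ → ℕ) :
    ∃ y : ℕ → freeLimit, ∀ m, y m = x m * y (m + 1) ^ k m := by
  have hone : ∀ n i, n ≤ i → freeLimitProj n (x i) = 1 := fun n i h =>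
    freeLimitProj_eq_one_of_le h (hx i)
  refine ⟨fun m => ⟨fun n => nestedProd (fun i => freeLimitProj n (x i)) k n m, fun n => ?_⟩,
    fun m => freeLimit_ext fun n => ?_⟩
  · rw [map_nestedProd]
    simp only [freeLimitProj_coherent]
    exact nestedProd_succ_of_eq_one k (hone n) n m (by omega)
  · rw [map_mul, map_pow]
    exact (nestedProd_succ_of_eq_one k (hone n) n m (by omega)).symm

/-- The recursion `v m = a m + (|a m| + 2) * v (m + 1)` has no integer solution when no `a m`
vanishes. -/
theorem not_forall_eq_add_mul (a v : ℕ → ℤ) (ha : ∀ m, a m ≠ 0) :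
    ¬ ∀ m, v m = a m + ((a m).natAbs + 2 : ℕ) * v (m + 1) := by
  intro hv
  -- A nonzero term is at most half of the term before it, so that some term vanishes.
  have half : ∀ m, v (m + 1) ≠ 0 → 2 * |v (m + 1)| ≤ |v m| := by
    intro m h0
    have h1 : 1 ≤ |v (m + 1)| := Int.one_le_abs h0
    have h2 : (|a m| + 2) * |v (m + 1)| ≤ |v m| + |a m| := by
      have h3 : (|a m| + 2) * v (m + 1) = v m - a m := by
        have := hv m
        push_cast at this
        rw [this]; ring
      rw [← abs_of_pos (show 0 < |a m| + 2 by positivity), ← abs_mul, h3]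
      exact abs_sub _ _
    nlinarith [abs_nonneg (a m)]
  have vanish : ∀ B : ℕ, ∀ m, |v m| ≤ B → ∃ i, v i = 0 := by
    intro B
    induction B with
    | zero => exact fun m h => ⟨m, abs_nonpos_iff.1 (by simpa using h)⟩
    | succ B ih =>
      intro m h
      by_cases h0 : v (m + 1) = 0
      · exact ⟨_, h0⟩
      · refine ih (m + 1) ?_
        have := half m h0
        have := Int.one_le_abs h0
        push_cast at h
        omega
  obtain ⟨i, hi⟩ := vanish (v 0).natAbs 0 (by simp)
  have hi' : v (i + 1) = 0 := by
    by_contra h0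
    have h1 := half i h0
    have h2 := Int.one_le_abs h0
    rw [hi, abs_zero] at h1
    omega
  have := hv i
  rw [hi, hi', mul_zero, add_zero] at this
  exact ha i this.symm

/-- Every homomorphism from the inverse limit to `ℤ` kills the kernel of one of the projections
to the groups `F n`. -/
theorem exists_forall_freeLimitProj_eq_one (f : freeLimit →* Multiplicative ℤ) :
    ∃ n, ∀ x, freeLimitProj n x = 1 → f x = 1 := by
  by_contra! h
  choose x hx hfx using h
  obtain ⟨y, hy⟩ := exists_nestedProd x hx fun m => (f (x m)).toAdd.natAbs + 2
  refine not_forall_eq_add_mul (fun m => (f (x m)).toAdd) (fun m => (f (y m)).toAdd)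
    (fun m h0 => hfx m (by simpa using h0)) fun m => ?_
  simpa using congrArg (fun z => (f z).toAdd) (hy m)

/-! ### Exponent sums and infinite products of generators -/

/-- The `i`-th free generator of `F n`, and `1` if `n ≤ i`. -/
def freeGen (n i : ℕ) : FreeGroup (Fin n) := if h : i < n then FreeGroup.of ⟨i, h⟩ else 1

theorem freeGen_of_le {n i : ℕ} (h : n ≤ i) : freeGen n i = 1 := by
  simp [freeGen, not_lt.2 h]

theorem freeBond_freeGen (n i : ℕ) : freeBond n (freeGen (n + 1) i) = freeGen n i := by
  unfold freeGen
  split_ifs with h1 h2 h2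
  · simp [freeBond, h2]
  · simp [freeBond, h2]
  · omega
  · exact map_one _

/-- The canonical homomorphism from `F n` to the inverse limit, a section of the projection. -/
def freeLimitSection (n : ℕ) : FreeGroup (Fin n) →* freeLimit :=
  FreeGroup.lift fun i => ⟨fun m => freeGen m i, fun m => freeBond_freeGen m i⟩

theorem freeLimitProj_section (n : ℕ) (w : FreeGroup (Fin n)) :
    freeLimitProj n (freeLimitSection n w) = w := by
  suffices (freeLimitProj n).comp (freeLimitSection n) = MonoidHom.id _ from
    DFunLike.congr_fun this w
  refine FreeGroup.ext_hom _ _ fun i => ?_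
  simp [freeLimitSection, freeLimitProj, freeGen]

/-- The exponent sum of the `i`-th generator, as a homomorphism. -/
def exponentSum (n i : ℕ) : FreeGroup (Fin n) →* Multiplicative ℤ :=
  FreeGroup.lift fun j => if (j : ℕ) = i then Multiplicative.ofAdd 1 else 1

theorem exponentSum_freeBond {n i : ℕ} (hi : i < n) (w : FreeGroup (Fin (n + 1))) :
    exponentSum n i (freeBond n w) = exponentSum (n + 1) i w := by
  suffices (exponentSum n i).comp (freeBond n) = exponentSum (n + 1) i from
    DFunLike.congr_fun this w
  refine FreeGroup.ext_hom _ _ fun j => ?_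
  by_cases hj : (j : ℕ) < n
  · simp [exponentSum, freeBond, hj]
  · simp [exponentSum, freeBond, hj, show (j : ℕ) ≠ i by omega]

/-- The exponent sum of the `i`-th generator in an element of the inverse limit. -/
def limitExponent (x : freeLimit) (i : ℕ) : ℤ :=
  (exponentSum (i + 1) i (freeLimitProj (i + 1) x)).toAdd

theorem exponentSum_freeLimitProj (x : freeLimit) {n i : ℕ} (hi : i < n) :
    (exponentSum n i (freeLimitProj n x)).toAdd = limitExponent x i := by
  induction n, Nat.succ_le_of_lt hi using Nat.le_induction with
  | base => rfl
  | succ n hn ih =>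
    rw [← ih hn, ← freeLimitProj_coherent x n, exponentSum_freeBond hn]

/-- A homomorphism from `F n` to a commutative group is determined by exponent sums. -/
theorem map_eq_prod_exponentSum {n : ℕ} {A : Type*} [CommGroup A] (φ : FreeGroup (Fin n) →* A)
    (w : FreeGroup (Fin n)) :
    φ w = ∏ i ∈ Finset.range n, φ (freeGen n i) ^ (exponentSum n i w).toAdd := by
  let ψ : FreeGroup (Fin n) →* A :=
    { toFun := fun w => ∏ i ∈ Finset.range n, φ (freeGen n i) ^ (exponentSum n i w).toAdd
      map_one' := by simp
      map_mul' := fun v w => by simp [zpow_add, Finset.prod_mul_distrib] }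
  suffices φ = ψ from DFunLike.congr_fun this w
  refine FreeGroup.ext_hom _ _ fun j => ?_
  change _ = ∏ i ∈ Finset.range n, _
  rw [Finset.prod_eq_single_of_mem (j : ℕ) (Finset.mem_range.2 j.2)]
  · simp [exponentSum, freeGen]
  · intro i _ hij
    simp [exponentSum, hij.symm]

/-- The product `f (k - 1) * ⋯ * f 1 * f 0`. The order is the one in which the product of the
fundamental group composes loops: the factor on the right is run through first. -/
def descProd {G : Type*} [Group G] (f : ℕ → G) : ℕ → G
  | 0 => 1
  | k + 1 => f k * descProd f k

theorem map_descProd {G G' : Type*} [Group G] [Group G'] (φ : G →* G') (f : ℕ → G) (k : ℕ) :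
    φ (descProd f k) = descProd (fun i => φ (f i)) k := by
  induction k with
  | zero => simp [descProd]
  | succ k ih => simp [descProd, ih]

theorem descProd_congr {G : Type*} [Group G] {f g : ℕ → G} {k : ℕ} (h : ∀ i < k, f i = g i) :
    descProd f k = descProd g k := by
  induction k with
  | zero => rfl
  | succ k ih => rw [descProd, descProd, h k (by omega), ih fun i hi => h i (by omega)]

theorem descProd_eq_prod {A : Type*} [CommGroup A] (f : ℕ → A) (k : ℕ) :
    descProd f k = ∏ i ∈ Finset.range k, f i := by
  induction k with
  | zero => rfl
  | succ k ih => rw [descProd, ih, Finset.prod_range_succ, mul_comm]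

/-- The infinite product of the powers `a i ^ e i` of the generators. -/
def genPowProd (e : ℕ → ℤ) : freeLimit :=
  ⟨fun n => descProd (fun i => freeGen n i ^ e i) n, fun n => by
    rw [map_descProd]
    simp only [map_zpow, freeBond_freeGen]
    rw [descProd, freeGen_of_le le_rfl, one_zpow, one_mul]⟩

theorem freeLimitProj_genPowProd (e : ℕ → ℤ) (n : ℕ) :
    freeLimitProj n (genPowProd e) = descProd (fun i => freeGen n i ^ e i) n := rfl

/-- Homomorphisms to `ℤ` do not separate an element of the inverse limit from the infinite product
of powers of generators with the same exponent sums. -/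
theorem map_genPowProd_limitExponent (f : freeLimit →* Multiplicative ℤ) (x : freeLimit) :
    f (genPowProd (limitExponent x)) = f x := by
  obtain ⟨n, hn⟩ := exists_forall_freeLimitProj_eq_one f
  have factor : ∀ z, f z = (f.comp (freeLimitSection n)) (freeLimitProj n z) := by
    intro z
    rw [← mul_inv_eq_one, MonoidHom.comp_apply, ← map_inv, ← map_mul]
    exact hn _ (by rw [map_mul, map_inv, freeLimitProj_section, mul_inv_cancel])
  rw [factor, factor x, freeLimitProj_genPowProd, map_descProd, descProd_eq_prod,
    map_eq_prod_exponentSum _ (freeLimitProj n x)]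
  refine Finset.prod_congr rfl fun i hi => ?_
  rw [map_zpow, exponentSum_freeLimitProj x (Finset.mem_range.1 hi)]

theorem mem_kerInto {A G : Type*} [Group A] [Group G] {x : G} :
    x ∈ kerInto A G ↔ ∀ f : G →* A, f x = 1 := by
  simp [kerInto, Subgroup.mem_iInf, MonoidHom.mem_ker]

/-! ### Infinite concatenation of loops -/

section InfiniteConcatenation

open Filter Topology

variable {X : Type*} [TopologicalSpace X] {x₀ : X}

/-- The concatenation of `α m`, `α (m + 1)`, …, `α (m + N - 1)` and a constant loop, each loop but
the last using the first half of the remaining time, as a function on the line. -/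
def partialConcat (α : ℕ → Path x₀ x₀) : ℕ → ℕ → ℝ → X
  | 0, _, _ => x₀
  | N + 1, m, t => if t ≤ 1 / 2 then (α m).extend (2 * t) else partialConcat α N (m + 1) (2 * t - 1)

variable (α : ℕ → Path x₀ x₀)

theorem partialConcat_of_nonpos (N m : ℕ) {t : ℝ} (ht : t ≤ 0) : partialConcat α N m t = x₀ := by
  cases N with
  | zero => rfl
  | succ N => rw [partialConcat, if_pos (by linarith), Path.extend_of_le_zero _ (by linarith)]

theorem continuous_partialConcat (N m : ℕ) : Continuous (partialConcat α N m) := by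
  induction N generalizing m with
  | zero => exact continuous_const
  | succ N ih =>
    refine Continuous.if_le ((α m).continuous_extend.comp (by fun_prop))
      ((ih (m + 1)).comp (by fun_prop)) continuous_id continuous_const fun t ht => ?_
    have ht' : t = 1 / 2 := ht
    subst ht'
    rw [partialConcat_of_nonpos α N (m + 1) (by norm_num)]
    norm_num

theorem partialConcat_succ {N m : ℕ} {t : ℝ} (ht : 1 < (1 - t) * 2 ^ N) :
    partialConcat α (N + 1) m t = partialConcat α N m t := by
  induction N generalizing m t with
  | zero =>
    have : t ≤ 0 := by
      rw [pow_zero, mul_one] at ht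
      linarith
    rw [partialConcat_of_nonpos α _ _ this, partialConcat_of_nonpos α _ _ this]
  | succ N ih =>
    have ht' : 1 < (1 - (2 * t - 1)) * 2 ^ N := by
      rw [pow_succ] at ht
      linear_combination ht
    rw [partialConcat, ih ht', ← partialConcat]

theorem partialConcat_of_le {N N' m : ℕ} {t : ℝ} (h : N ≤ N') (ht : 1 < (1 - t) * 2 ^ N) :
    partialConcat α N' m t = partialConcat α N m t := by
  induction N', h using Nat.le_induction with
  | base => rfl
  | succ N' h ih =>
    rw [← ih]
    refine partialConcat_succ α (ht.trans_le ?_)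
    have : 0 ≤ 1 - t := by
      by_contra hc
      have := mul_neg_of_neg_of_pos (not_le.1 hc) (show (0 : ℝ) < 2 ^ N by positivity)
      linarith
    gcongr
    norm_num

/-- The infinite concatenation of `α m`, `α (m + 1)`, … as a function on the line. For `t < 1`
the index exceeds `1 / (1 - t)`, so that the partial concatenations have become
stationary at `t`; for `1 ≤ t` it is `0`, and the value is the base point. -/
def infiniteConcatFun (m : ℕ) (t : ℝ) : X := partialConcat α ⌈1 / (1 - t)⌉₊ m t

theorem infiniteConcatFun_of_one_le (m : ℕ) {t : ℝ} (ht : 1 ≤ t) :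
    infiniteConcatFun α m t = x₀ := by
  have : ⌈1 / (1 - t)⌉₊ = 0 :=
    Nat.ceil_eq_zero.2 (div_nonpos_of_nonneg_of_nonpos zero_le_one (by linarith))
  rw [infiniteConcatFun, this]
  rfl

theorem one_lt_mul_two_pow_ceil {t : ℝ} (ht : t < 1) : 1 < (1 - t) * 2 ^ ⌈1 / (1 - t)⌉₊ := by
  have h0 : 0 < 1 - t := by linarith
  have h1 : 1 / (1 - t) < 2 ^ ⌈1 / (1 - t)⌉₊ :=
    (Nat.le_ceil _).trans_lt (by exact_mod_cast Nat.lt_two_pow_self)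
  rwa [div_lt_iff₀ h0, mul_comm] at h1

theorem infiniteConcatFun_eq_partialConcat {N m : ℕ} {t : ℝ} (ht : 1 < (1 - t) * 2 ^ N) :
    infiniteConcatFun α m t = partialConcat α N m t := by
  have ht1 : t < 1 := by
    by_contra hc
    have := mul_nonpos_of_nonpos_of_nonneg (show 1 - t ≤ 0 by linarith)
      (show (0 : ℝ) ≤ 2 ^ N by positivity)
    linarith
  rw [infiniteConcatFun]
  rcases le_total N ⌈1 / (1 - t)⌉₊ with h | h
  · exact partialConcat_of_le α h ht
  · exact (partialConcat_of_le α h (one_lt_mul_two_pow_ceil ht1)).symm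

theorem infiniteConcatFun_eq_ite (m : ℕ) (t : ℝ) : infiniteConcatFun α m t =
    if t ≤ 1 / 2 then (α m).extend (2 * t) else infiniteConcatFun α (m + 1) (2 * t - 1) := by
  rcases le_or_gt 1 t with ht | ht
  · rw [if_neg (by linarith), infiniteConcatFun_of_one_le α _ ht,
      infiniteConcatFun_of_one_le α _ (by linarith)]
  · have h := one_lt_mul_two_pow_ceil ht
    set N := ⌈1 / (1 - t)⌉₊
    have h' : 1 < (1 - t) * 2 ^ (N + 1) := by rw [pow_succ]; linarith
    rw [infiniteConcatFun_eq_partialConcat α h', partialConcat,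
      infiniteConcatFun_eq_partialConcat α (N := N)]
    rw [pow_succ] at h'
    linear_combination h'

theorem infiniteConcatFun_mem {S : Set X} (h0 : x₀ ∈ S) {m : ℕ}
    (hS : ∀ k, m ≤ k → Set.range (α k) ⊆ S) (t : ℝ) : infiniteConcatFun α m t ∈ S := by
  rw [infiniteConcatFun]
  generalize ⌈1 / (1 - t)⌉₊ = N
  induction N generalizing m t with
  | zero => exact h0
  | succ N ih =>
    rw [partialConcat]
    split_ifs
    · refine hS m le_rfl ?_
      rw [← Path.extend_range]
      exact Set.mem_range_self _
    · exact ih (fun k hk => hS k (by omega)) _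

/-- The infinite concatenation is continuous if the loops shrink to the base point. Before the
time `1` it agrees locally with a partial concatenation; at the time `1` continuity is clear for
the tail of loops in a given neighbourhood, and passes from each tail to the one before it. -/
theorem continuous_infiniteConcatFun
    (hα : ∀ U ∈ 𝓝 x₀, ∃ M, ∀ k, M ≤ k → Set.range (α k) ⊆ U) (m : ℕ) :
    Continuous (infiniteConcatFun α m) := by
  rw [continuous_iff_continuousAt]
  intro t
  rcases lt_trichotomy t 1 with ht | rfl | ht
  · have h := one_lt_mul_two_pow_ceil ht
    set N := ⌈1 / (1 - t)⌉₊
    refine (continuous_partialConcat α N m).continuousAt.congr ?_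
    have : ∀ᶠ s : ℝ in 𝓝 t, 1 < (1 - s) * 2 ^ N :=
      continuousAt_const.eventually_lt
        (show ContinuousAt (fun s : ℝ => (1 - s) * 2 ^ N) t by fun_prop) h
    filter_upwards [this] with s hs
    exact (infiniteConcatFun_eq_partialConcat α hs).symm
  · rw [ContinuousAt, infiniteConcatFun_of_one_le α m le_rfl]
    intro U hU
    rw [Filter.mem_map]
    obtain ⟨M, hM⟩ := hα U hU
    have step : ∀ j m, M ≤ j + m → ∀ᶠ s : ℝ in 𝓝 1, infiniteConcatFun α m s ∈ U := by
      intro j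
      induction j with
      | zero =>
        exact fun m hm => Eventually.of_forall
          (infiniteConcatFun_mem α (mem_of_mem_nhds hU) fun k hk => hM k (by omega))
      | succ j ih =>
        intro m hm
        have hlim : Tendsto (fun s : ℝ => 2 * s - 1) (𝓝 1) (𝓝 1) := by
          have : ContinuousAt (fun s : ℝ => 2 * s - 1) 1 := by fun_prop
          rw [ContinuousAt] at this
          norm_num at this
          exact this
        filter_upwards [hlim.eventually (ih (m + 1) (by omega)),
          lt_mem_nhds (show (1 / 2 : ℝ) < 1 by norm_num)] with s hs hs'
        rwa [infiniteConcatFun_eq_ite, if_neg (not_le.2 hs')]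
    exact step M m (by omega)
  · refine (continuousAt_const (y := x₀)).congr ?_
    filter_upwards [lt_mem_nhds ht] with s hs
    exact (infiniteConcatFun_of_one_le α m hs.le).symm

/-- The infinite concatenation of `α m`, `α (m + 1)`, …, for loops that shrink to the base point. -/
def infiniteConcat (hα : ∀ U ∈ 𝓝 x₀, ∃ M, ∀ k, M ≤ k → Set.range (α k) ⊆ U) (m : ℕ) :
    Path x₀ x₀ where
  toFun t := infiniteConcatFun α m t
  continuous_toFun := (continuous_infiniteConcatFun α hα m).comp continuous_subtype_val
  source' := by
    rw [infiniteConcatFun_eq_ite]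
    simp
  target' := infiniteConcatFun_of_one_le α m (by simp)

theorem infiniteConcat_eq_trans (hα : ∀ U ∈ 𝓝 x₀, ∃ M, ∀ k, M ≤ k → Set.range (α k) ⊆ U)
    (m : ℕ) : infiniteConcat α hα m = (α m).trans (infiniteConcat α hα (m + 1)) := by
  ext t
  rw [Path.trans_apply]
  refine (infiniteConcatFun_eq_ite α m t).trans ?_
  by_cases h : (t : ℝ) ≤ 1 / 2
  · rw [if_pos h, dif_pos h]
    exact Path.extend_apply _ _
  · rw [if_neg h, dif_neg h]
    rfl

end InfiniteConcatenation

/-! ### Loops in the Hawaiian earring -/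

theorem circleLoop_mem (i : ℕ) (t : unitInterval) :
    (earringRadius i : ℂ) * (1 - Complex.exp (2 * Real.pi * (t : ℝ) * Complex.I)) ∈
      earringCircle i := by
  rw [mem_earringCircle]
  have hexp : Complex.normSq (Complex.exp (2 * Real.pi * (t : ℝ) * Complex.I)) = 1 := by
    have := Complex.norm_exp_ofReal_mul_I (2 * Real.pi * (t : ℝ))
    push_cast at this
    rw [Complex.normSq_eq_norm_sq, this, one_pow]
  generalize Complex.exp (2 * Real.pi * (t : ℝ) * Complex.I) = z at hexp
  have h1 : earringRadius i * ((i : ℝ) + 1) = 1 := by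
    unfold earringRadius; field_simp
  rw [Complex.normSq_apply] at hexp
  simp [Complex.normSq_apply]
  linear_combination earringRadius i * ((1 - z.re) ^ 2 + z.im ^ 2) * h1 + earringRadius i * hexp

/-- The base point of the `i`-th circle. -/
def circleBase (i : ℕ) : earringCircle i := ⟨0, zero_mem_earringCircle i⟩

/-- The loop that runs once around the `i`-th circle. -/
def circleLoop (i : ℕ) : Path (circleBase i) (circleBase i) where
  toFun t := ⟨_, circleLoop_mem i t⟩
  continuous_toFun := by
    refine Continuous.subtype_mk ?_ _
    fun_prop
  source' := Subtype.ext (by simp [circleBase])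
  target' := Subtype.ext (by simp [circleBase, Complex.exp_two_pi_mul_I])

/-- The inclusion of the `i`-th circle in the Hawaiian earring. -/
def circleInclusion (i : ℕ) : C(earringCircle i, HawaiianEarring) :=
  ⟨Set.inclusion (Set.subset_iUnion earringCircle i), continuous_inclusion _⟩

theorem circleInclusion_base (i : ℕ) : circleInclusion i (circleBase i) = earringBase := rfl

/-- The inclusion of the `i`-th circle on fundamental groups. -/
def circleToEarring (i : ℕ) : FundamentalGroup (earringCircle i) (circleBase i) →*
    FundamentalGroup HawaiianEarring earringBase :=
  FundamentalGroup.mapOfEq (circleInclusion i) (circleInclusion_base i)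

theorem circleToEarring_mk (i : ℕ) (p : Path (circleBase i) (circleBase i)) :
    circleToEarring i (Path.Homotopic.Quotient.mk p) =
      Path.Homotopic.Quotient.mk (p.map (circleInclusion i).continuous) := by
  rw [circleToEarring, FundamentalGroup.mapOfEq_apply]
  rfl

theorem earringToWedge_mk (n : ℕ) (p : Path earringBase earringBase) :
    earringToWedge n (Path.Homotopic.Quotient.mk p) =
      Path.Homotopic.Quotient.mk ((p.map (collapse n).continuous).cast
        (collapse_base n).symm (collapse_base n).symm) := by
  rw [earringToWedge, FundamentalGroup.mapOfEq_apply]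
  rfl

theorem collapse_eq_of_mem {n i : ℕ} (hi : i < n) {z : HawaiianEarring}
    (hz : (z : ℂ) ∈ earringCircle i) : (collapse n z : ℂ) = z := by
  have h : (z : ℂ) ∈ CircleWedge n := Or.inr (Set.mem_iUnion.2 ⟨⟨i, hi⟩, hz⟩)
  change (collapseFun n z : ℂ) = z
  rw [collapseFun, dif_pos h]

theorem collapse_eq_base_of_mem {n i : ℕ} (hi : n ≤ i) {z : HawaiianEarring}
    (hz : (z : ℂ) ∈ earringCircle i) : collapse n z = wedgeBase n := by
  change collapseFun n z = wedgeBase n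
  rw [collapseFun]
  split_ifs with h
  · refine Subtype.ext ?_
    rcases h with h | h
    · exact h
    · -- Two different circles meet only in the origin.
      obtain ⟨j, hj⟩ := Set.mem_iUnion.1 h
      rw [mem_earringCircle] at hz hj
      have hji : (j : ℝ) < i := by exact_mod_cast j.2.trans_le hi
      have : ((i : ℝ) - j) * Complex.normSq (z : ℂ) = 0 := by linear_combination hz - hj
      exact Complex.normSq_eq_zero.1 ((mul_eq_zero.1 this).resolve_left (by linarith))
  · rfl

theorem earringToWedge_circleLoop {n i : ℕ} (hi : i < n) :
    earringToWedge n (circleToEarring i (Path.Homotopic.Quotient.mk (circleLoop i))) =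
      freeToWedge n (freeGen n i) := by
  rw [freeGen, dif_pos hi, freeToWedge, FreeGroup.lift_apply_of, circleToEarring_mk]
  refine (earringToWedge_mk n _).trans ?_
  refine congrArg Path.Homotopic.Quotient.mk (Path.ext (funext fun t => Subtype.ext ?_))
  exact collapse_eq_of_mem hi (circleLoop_mem i t)

/-- The circles shrink to the origin. -/
theorem exists_forall_circleInclusion_mem {U : Set HawaiianEarring} (hU : U ∈ nhds earringBase) :
    ∃ M, ∀ k, M ≤ k → ∀ z, circleInclusion k z ∈ U := by
  obtain ⟨ε, hε, hball⟩ := Metric.mem_nhds_iff.1 hU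
  obtain ⟨M, hM⟩ := exists_nat_one_div_lt (show 0 < ε / 2 by positivity)
  refine ⟨M, fun k hk z => hball ?_⟩
  rw [Metric.mem_ball, Subtype.dist_eq, dist_comm]
  have h1 : dist (z : ℂ) (earringRadius k : ℂ) = earringRadius k := z.2
  have h2 : dist (0 : ℂ) (earringRadius k : ℂ) = earringRadius k := zero_mem_earringCircle k
  have h3 : earringRadius k ≤ 1 / ((M : ℝ) + 1) := by
    unfold earringRadius
    gcongr
  calc dist (0 : ℂ) (z : ℂ)
      ≤ dist (0 : ℂ) (earringRadius k : ℂ) + dist (z : ℂ) (earringRadius k : ℂ) :=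
        dist_triangle_right _ _ _
    _ < ε := by rw [h1, h2]; linarith

/-- The infinite product of powers of the generators is represented by a loop in `H`, the infinite
concatenation of loops that wind `e i` times around the `i`-th circle. -/
theorem genPowProd_mem_HEG (e : ℕ → ℤ) : genPowProd e ∈ HEG := by
  rw [mem_HEG]
  -- The powers are taken inside the circle, so that their representatives stay there.
  have hp : ∀ i, ∃ p : Path (circleBase i) (circleBase i), (Path.Homotopic.Quotient.mk p :
      FundamentalGroup (earringCircle i) (circleBase i)) =
      FundamentalGroup.fromPath (Path.Homotopic.Quotient.mk (circleLoop i)) ^ e i := fun i =>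
    Path.Homotopic.Quotient.mk_surjective _
  choose p hp using hp
  let α : ℕ → Path earringBase earringBase := fun i => (p i).map (circleInclusion i).continuous
  have hα : ∀ U ∈ nhds earringBase, ∃ M, ∀ k, M ≤ k → Set.range (α k) ⊆ U := fun U hU => by
    obtain ⟨M, hM⟩ := exists_forall_circleInclusion_mem hU
    exact ⟨M, fun k hk => Set.range_subset_iff.2 fun t => hM k hk (p k t)⟩
  let γ : ℕ → Path earringBase earringBase := infiniteConcat α hα
  let a : ℕ → FundamentalGroup HawaiianEarring earringBase := fun i =>
    FundamentalGroup.fromPath (Path.Homotopic.Quotient.mk (α i))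
  let g : ℕ → FundamentalGroup HawaiianEarring earringBase := fun i =>
    FundamentalGroup.fromPath (Path.Homotopic.Quotient.mk (γ i))
  have hg : ∀ k, g 0 = g k * descProd a k := by
    intro k
    induction k with
    | zero => exact (mul_one _).symm
    | succ k ih =>
      have : g k = g (k + 1) * a k := by
        rw [FundamentalGroup.mul_def]
        change Path.Homotopic.Quotient.mk (γ k) = _
        rw [show γ k = (α k).trans (γ (k + 1)) from infiniteConcat_eq_trans α hα k]
        rfl
      rw [ih, this, mul_assoc]
      rfl
  refine ⟨g 0, fun n => ?_⟩
  have hgn : earringToWedge n (g n) = 1 := by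
    change earringToWedge n (Path.Homotopic.Quotient.mk (γ n)) = _
    rw [earringToWedge_mk]
    refine congrArg Path.Homotopic.Quotient.mk (a₂ := Path.refl _) (Path.ext (funext fun t => ?_))
    exact infiniteConcatFun_mem α (S := {z | collapse n z = wedgeBase n}) (collapse_base n)
      (fun k hk => Set.range_subset_iff.2 fun t => collapse_eq_base_of_mem hk (p k t).2) t
  rw [hg n, map_mul, hgn, one_mul, freeLimitProj_genPowProd, map_descProd, map_descProd]
  refine descProd_congr fun i hi => ?_
  rw [map_zpow, ← earringToWedge_circleLoop hi, ← map_zpow, ← map_zpow]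
  refine congrArg (earringToWedge n) ?_
  exact (circleToEarring_mk i (p i)).symm.trans (congrArg (circleToEarring i) (hp i))

end

theorem theorem4 :
    (HEG : Set freeLimit) * (kerInto (Multiplicative ℤ) freeLimit : Set freeLimit) =
      Set.univ := by
  refine Set.eq_univ_of_forall fun x => ?_
  refine ⟨genPowProd (limitExponent x), genPowProd_mem_HEG _,
    (genPowProd (limitExponent x))⁻¹ * x, ?_, mul_inv_cancel_left _ _⟩
  refine mem_kerInto.2 fun f => ?_
  rw [map_mul, map_inv, map_genPowProd_limitExponent, inv_mul_cancel]
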